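/- Let $R$ be an integral domain with quotient field $K$. For a nonzero $R$-submodule $I$ of $K$ put $I^{-1}=(R:_K I)=\{x\in K: xI\subseteq R\}$, $I_v=(I^{-1})^{-1}$ and $I_t=\bigcup J_v$, where $J$ ranges over the nonzero finitely generated submodules of $I$. A $t$-ideal is a nonzero ideal $I$ of $R$ with $I=I_t$; a $t$-prime is a prime $t$-ideal; $t\text{-Max}(R)$ is the set of maximal $t$-ideals, i.e. the maximal elements of the set of proper $t$-ideals (they are prime). An ideal is $v$-finite if it equals $J_v$ for some nonzero finitely generated ideal $J$. An overring of $R$ is a ring $T$ with $R\subseteq T\subseteq K$; it is again a domain with quotient field $K$, and all notions apply to it. Localizations are taken inside $K$, and an empty intersection of localizations is $K$. $R$ is a *$t\#$-domain* if $\bigcap_{M\in\mathcal M_1}R_M\neq\bigcap_{M\in\mathcal M_2}R_M$ for any two distinct subsets $\mathcal M_1,\mathcal M_2$ of $t\text{-Max}(R)$. $R$ is a *PVMD* if $R_M$ is a valuation domain for every $M\in t\text{-Max}(R)$. For a set $\Lambda$ of $t$-primes of $R$ let $\Phi(\Lambda)$ be the set of $t$-ideals of $R$ contained in no $P\in\Lambda$,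 and let $R_{\Phi(\Lambda)}=\{x\in K: xI\subseteq R\text{ for some }I\in\Phi(\Lambda)\}$. $\Phi(\Lambda)$ is *$v$-finite* if each ideal in $\Phi(\Lambda)$ contains a $v$-finite ideal which is also in $\Phi(\Lambda)$. An overring $T$ of $R$ is a *$t$-subintersection* of $R$ if $T=\bigcap_{P\in\Lambda}R_P$ for some set $\Lambda$ of $t$-primes of $R$; it is *$t$-flat* over $R$ if $T_M=R_{M\cap R}$ for each $M\in t\text{-Max}(T)$; it is *$t$-linked* over $R$ if for each finitely generated ideal $I$ of $R$ with $(R:_KI)=R$ we have $(T:_KIT)=T$. **Proposition.** Let $R$ be a PVMD with quotient field $K$. The following statements are equivalent. 1. Each $t$-flat overring of $R$ is a $t\#$-domain. 2. Each $t$-subintersection of $R$ is a $t\#$-domain. 3. For each set $\Lambda$ of pairwise incomparable $t$-primes of $R$, $\Phi(\Lambda)$ is $v$-finite. 4. If $T$ is a $t$-subintersection of $R$, there exists a unique set $\Lambda$ of pairwise incomparable $t$-primes of $R$ such that $T=R_{\Phi(\Lambda)}$; moreover, $\Lambda=\{M\cap R: M\in t\text{-Max}(T)\}$. 5. If $T$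 is a $t$-flat overring of $R$ and $T=\bigcap_{Q\in\Lambda}T_Q$ for some set $\Lambda$ of pairwise incomparable $t$-primes of $T$, then $\Lambda=t\text{-Max}(T)$. 6. If $\Lambda\subseteq t\text{-Max}(R)$, then $\Phi(\Lambda)$ is $v$-finite. 7. Each $t$-prime $P$ of $R$ contains a finitely generated ideal which is not contained in any maximal $t$-ideal of $R$ not containing $P$. 8. For each $t$-prime $P$ of $R$ there exists an element $u\in K$ such that $(R:_Ru)=\{r\in R: ru\in R\}\subseteq P$ and $(R:_Ru)\nsubseteq M$ for each maximal $t$-ideal $M$ not containing $P$. 9. For each $t$-prime $P$ of $R$, $R_P\nsupseteq\bigcap R_M$, where $M$ ranges over the maximal $t$-ideals of $R$ not containing $P$. 10. Each $t$-linked overring of $R$ is a $t\#$-domain. 11. For each $t$-prime $P$ of $R$, the ring $(P:P)=\{x\in K: xP\subseteq P\}$ is a $t\#$-domain. -/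

import Mathlib

/-!
Throughout, `A` is an integral domain and `K` is its quotient field (`IsFractionRing A K`).
Fractional ideals are `A`-submodules of `K`, overrings of `A` are the subalgebras of `K` over `A`,
and prime ideals are points of `PrimeSpectrum A`.
-/

namespace TSharp

open IsLocalization

section StarOperations

variable {A : Type*} [CommRing A] (K : Type*) [Field K] [Algebra A K]

variable {K} in
/-- The divisorial closure `I_v = (I⁻¹)⁻¹`, where `I⁻¹ = (A :_K I) = 1 / I`
(here `1` is `A` as a submodule of `K`). -/
noncomputable def vClosure (I : Submodule A K) : Submodule A K := 1 / (1 / I)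

variable {K} in
/-- The `t`-closure `I_t = ⋃ J_v`, where `J` ranges over the nonzero finitely generated
submodules of `I`. -/
def tClosure (I : Submodule A K) : Set K :=
  ⋃ J ∈ {J : Submodule A K | J.FG ∧ J ≠ ⊥ ∧ J ≤ I}, (vClosure J : Set K)

/-- A `t`-ideal of `A`: a nonzero ideal `I` with `I = I_t`. -/
def IsTIdeal (I : Ideal A) : Prop :=
  I ≠ ⊥ ∧ (coeSubmodule K I : Set K) = tClosure (coeSubmodule K I)

/-- A `v`-finite ideal: an ideal of the form `J_v`, `J` a nonzero finitely generated ideal. -/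
def IsVFinite (I : Ideal A) : Prop :=
  ∃ J : Ideal A, J.FG ∧ J ≠ ⊥ ∧ coeSubmodule K I = vClosure (coeSubmodule K J)

/-- A maximal `t`-ideal: maximal among the proper `t`-ideals. -/
def IsMaximalTIdeal (M : Ideal A) : Prop :=
  Maximal (fun I : Ideal A => I ≠ ⊤ ∧ IsTIdeal K I) M

variable {K} in
/-- A maximal `t`-ideal is prime. -/
theorem IsMaximalTIdeal.isPrime [IsFractionRing A K] {M : Ideal A} (hM : IsMaximalTIdeal K M) : M.IsPrime := by
  obtain ⟨⟨hne, hbot, hcl⟩, hmax⟩ := hM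
  have hinj : Function.Injective (algebraMap A K) := IsFractionRing.injective A K
  refine ⟨hne, fun {a b} hab => or_iff_not_imp_left.2 fun ha => ?_⟩
  have ha0 : a ≠ 0 := fun h => ha (h ▸ M.zero_mem)
  have hle : M ≤ M.colon {a} := fun x hx => by
    simpa [mul_comm] using M.mul_mem_right a hx
  have hmem : ∀ x : A, algebraMap A K x ∈ tClosure (coeSubmodule K M) → x ∈ M := by
    intro x hx
    rw [← hcl] at hx
    obtain ⟨y, hy, hxy⟩ := (mem_coeSubmodule K M).1 hx
    exact hinj hxy ▸ hy
  have key : M.colon {a} ≤ M := by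
    refine hmax ⟨fun h => ?_, fun h => hbot (le_bot_iff.1 (h ▸ hle)), ?_⟩ hle
    · have h1 : (1 : A) ∈ M.colon {a} := h ▸ Submodule.mem_top
      exact ha (by simpa using h1)
    · apply Set.Subset.antisymm
      · intro x hx
        by_cases hx0 : x = 0
        · obtain ⟨m, hm, hm0⟩ := Submodule.exists_mem_ne_zero_of_ne_bot hbot
          refine Set.mem_biUnion (x := Submodule.span A {algebraMap A K m})
            ⟨Submodule.fg_span_singleton _, ?_, ?_⟩ (hx0 ▸ Submodule.zero_mem _)
          · simpa using hm0
          · rw [Submodule.span_singleton_le_iff_mem]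
            exact (mem_coeSubmodule K _).2 ⟨m, hle hm, rfl⟩
        · refine Set.mem_biUnion (x := Submodule.span A {x})
            ⟨Submodule.fg_span_singleton _, ?_, ?_⟩ ?_
          · simpa using hx0
          · rw [Submodule.span_singleton_le_iff_mem]; exact hx
          · intro y hy
            rw [mul_comm]
            exact hy x (Submodule.mem_span_singleton_self x)
      · intro x hx
        obtain ⟨J, ⟨hfg, hJ0, hJle⟩, hxJ⟩ := Set.mem_iUnion₂.1 hx
        have hx1 : x ∈ (1 : Submodule A K) := by
          have := hxJ 1 (fun z hz => by
            obtain ⟨w, -, rfl⟩ := (mem_coeSubmodule K _).1 (hJle hz)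
            rw [one_mul]; exact Submodule.algebraMap_mem w)
          simpa using this
        obtain ⟨r, rfl⟩ := Submodule.mem_one.1 hx1
        refine (mem_coeSubmodule K _).2 ⟨r, ?_, rfl⟩
        rw [Submodule.mem_colon_singleton, smul_eq_mul]
        apply hmem
        have ha' : algebraMap A K a ≠ 0 := by simpa using ha0
        refine Set.mem_biUnion (x := J.map (LinearMap.lsmul A K a)) ⟨hfg.map _, ?_, ?_⟩ ?_
        · obtain ⟨z, hz, hz0⟩ := Submodule.exists_mem_ne_zero_of_ne_bot hJ0
          refine Submodule.ne_bot_iff _ |>.2 ⟨a • z, ⟨z, hz, rfl⟩, ?_⟩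
          rw [Algebra.smul_def]; exact mul_ne_zero ha' hz0
        · rintro _ ⟨z, hz, rfl⟩
          obtain ⟨w, hw, rfl⟩ := (mem_coeSubmodule K _).1 (hJle hz)
          refine (mem_coeSubmodule K _).2 ⟨w * a, by simpa using hw, ?_⟩
          simp [Algebra.smul_def, mul_comm]
        · intro y hy
          have := hxJ (y * algebraMap A K a) (fun z hz => by
            have := hy (a • z) ⟨z, hz, rfl⟩
            rwa [Algebra.smul_def, ← mul_assoc] at this)
          rwa [map_mul, mul_assoc, mul_comm (algebraMap A K a)]
  exact key (by simpa [mul_comm] using hab)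

/-- The set of `t`-primes (prime `t`-ideals; these are nonzero). -/
def tSpec (A : Type*) [CommRing A] (K : Type*) [Field K] [Algebra A K] :
    Set (PrimeSpectrum A) := {P | IsTIdeal K P.asIdeal}

/-- The set of maximal `t`-ideals. Every maximal `t`-ideal is prime, see
`IsMaximalTIdeal.isPrime`, so that nothing is lost by working inside `PrimeSpectrum A`. -/
def tMax (A : Type*) [CommRing A] (K : Type*) [Field K] [Algebra A K] :
    Set (PrimeSpectrum A) := {M | IsMaximalTIdeal K M.asIdeal}

/-- `Φ(Λ)`: the `t`-ideals contained in no `P ∈ Λ`. -/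
def Phi (Λ : Set (PrimeSpectrum A)) : Set (Ideal A) :=
  {I | IsTIdeal K I ∧ ∀ P ∈ Λ, ¬ I ≤ P.asIdeal}

/-- A system of ideals `Φ` is `v`-finite if each `t`-ideal in `Φ` contains a `v`-finite ideal
which is also in `Φ`. -/
def IsVFiniteSystem (Φ : Set (Ideal A)) : Prop :=
  ∀ I ∈ Φ, IsTIdeal K I → ∃ J ∈ Φ, J ≤ I ∧ IsVFinite K J

/-- `A_Φ = {x ∈ K | xI ⊆ A for some I ∈ Φ}`. -/
def quotientRing (Φ : Set (Ideal A)) : Set K :=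
  {x | ∃ I ∈ Φ, ∀ a ∈ I, x * algebraMap A K a ∈ Set.range (algebraMap A K)}

/-- The conductor `(A :_A u) = {a ∈ A | a u ∈ A}` of an element `u ∈ K`. -/
def elemConductor (A : Type*) [CommRing A] {K : Type*} [Field K] [Algebra A K] (u : K) : Ideal A :=
  (1 : Submodule A K).colon {u}

/-- The overring `(I : I) = {x ∈ K | xI ⊆ I}`. -/
def endoRing (I : Ideal A) : Subalgebra A K where
  carrier := {x | ∀ y ∈ coeSubmodule K I, x * y ∈ coeSubmodule K I}
  mul_mem' ha hb y hy := by rw [mul_assoc]; exact ha _ (hb _ hy)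
  add_mem' ha hb y hy := by rw [add_mul]; exact add_mem (ha _ hy) (hb _ hy)
  algebraMap_mem' r y hy := by
    rw [← Algebra.smul_def]; exact Submodule.smul_mem _ r hy

end StarOperations

section Localizations

variable {A : Type*} [CommRing A] [IsDomain A] (K : Type*) [Field K] [Algebra A K]
  [IsFractionRing A K]

/-- The localization `A_P` at a prime `P`, as a subring of `K`. -/
noncomputable def locAt (P : PrimeSpectrum A) : Subalgebra A K :=
  Localization.subalgebra.ofField K P.asIdeal.primeCompl P.asIdeal.primeCompl_le_nonZeroDivisors

/-- `⋂_{P ∈ Λ} A_P`, which is `K` if `Λ` is empty. -/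
noncomputable def interLoc (Λ : Set (PrimeSpectrum A)) : Subalgebra A K := ⨅ P ∈ Λ, locAt K P

/-- `A` is a `t#`-domain: distinct sets of maximal `t`-ideals have distinct intersections of
localizations. -/
def IsTSharp (A : Type*) [CommRing A] [IsDomain A] (K : Type*) [Field K] [Algebra A K]
    [IsFractionRing A K] : Prop :=
  ∀ M₁ M₂ : Set (PrimeSpectrum A), M₁ ⊆ tMax A K → M₂ ⊆ tMax A K → M₁ ≠ M₂ →
    interLoc K M₁ ≠ interLoc K M₂

/-- Prüfer `v`-multiplication domains: `A_M` is a valuation domain for each maximal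
`t`-ideal `M`. -/
def IsPVMD (A : Type*) [CommRing A] [IsDomain A] (K : Type*) [Field K] [Algebra A K]
    [IsFractionRing A K] : Prop :=
  ∀ M ∈ tMax A K, ValuationRing (locAt K M)

variable {K}

/-- The contraction `Q ∩ A` of a prime `Q` of an overring `T` of `A`. -/
def contract (T : Subalgebra A K) (Q : PrimeSpectrum T) : PrimeSpectrum A :=
  PrimeSpectrum.comap (algebraMap A T) Q

/-- `T` is a `t`-subintersection of `A`: an intersection of localizations of `A` at
`t`-primes. -/
def IsTSubintersection (T : Subalgebra A K) : Prop :=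
  ∃ Λ : Set (PrimeSpectrum A), Λ ⊆ tSpec A K ∧ T = interLoc K Λ

/-- `T` is `t`-flat over `A`: `T_M = A_{M ∩ A}` for each maximal `t`-ideal `M` of `T`. -/
def IsTFlat (T : Subalgebra A K) : Prop :=
  ∀ M ∈ tMax T K, (locAt K M : Set K) = locAt K (contract T M)

/-- `T` is `t`-linked over `A`: for each finitely generated ideal `I` of `A`, if `(A : I) = A`
then `(T : IT) = T`. -/
def IsTLinked (T : Subalgebra A K) : Prop :=
  ∀ I : Ideal A, I.FG → (1 : Submodule A K) / coeSubmodule K I = 1 →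
    (1 : Submodule T K) / coeSubmodule K (I.map (algebraMap A T)) = 1

end Localizations

end TSharp

/-!
Over a PVMD `R`, the `t`-linked overrings, the `t`-flat overrings and the `t`-subintersections are
the same rings `T`: if `N` is a maximal `t`-ideal of a `t`-linked `T`, then `N ∩ R` lies in a
maximal `t`-ideal of `R`, so `R_{N ∩ R}` is a valuation ring, and it equals `T_N` because `T_N`
dominates it (`IsTLinked.isTFlat`, `IsTFlat.isTSubintersection`, `IsTSubintersection.isTLinked`).
In particular `T` is a PVMD and `T = ⋂ R_{N ∩ R}`; conversely each `t`-prime `P` of `R` with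
`T ⊆ R_P` lifts to a `t`-prime of `T` with the same localization (`exists_lift_tSpec`).

Two finiteness facts do the work. A nonzero finitely generated ideal `J` satisfies `J J⁻¹ ⊄ P` for
each valuation prime `P` (`IsValuationAt.exists_mul_notMem`), and in a PVMD a conductor `(R : u)`
is the `v`-closure of a finitely generated ideal (`exists_fg_le_elemConductor`). Hence an element
`u` that separates a maximal `t`-ideal from the others can be traded for a finitely generated ideal,
and conversely.

* If each `t`-prime `P` of `R` contains a finitely generated ideal that lies in no maximal `t`-ideal
  other than those containing `P`, then every `t`-flat overring is a `t#`-domain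
  (`IsTFlat.isTSharp`).
* In a `t#`-domain that is a PVMD, `t-Max` is the only antichain of `t`-primes whose localizations
  intersect in the domain (`IsTSharp.eq_tMax_of_interLoc`). For overrings this gives the uniqueness
  statements about representing antichains (`eq_image_contract`). It also gives the `v`-finiteness
  of `Φ(Λ)`, since a `t`-ideal in `Φ(Λ)` then extends to an ideal of `⋂_{P ∈ Λ} R_P` whose
  `t`-closure is the whole ring (`isVFiniteSystem_Phi_image_contract`).
* If `⋂ R_M ⊆ R_P`, with `M` ranging over the maximal `t`-ideals not containing `P`, then
  `(P : P) = ⋂ R_M` by `endoRing_eq_interLoc`. These `M` do not account for the maximal `t`-ideals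
  of `(P : P)` that contain `P`, so `(P : P)` is not a `t#`-domain
  (`not_interLoc_le_of_isTSharp_endoRing`).

For an ideal `J` of `A`, statements about `J_v` are phrased through the ideal `vIdeal K J` of `A`,
and membership in `A ⊆ K` is written as membership in `⊥ : Subalgebra A K`.
-/

namespace TSharp

open IsLocalization

/-! ### Finitely generated subideals of sums and extensions -/

theorem exists_fg_le_sup {A : Type*} [CommRing A] {F I J : Ideal A} (hF : F.FG) (h : F ≤ I ⊔ J) :
    ∃ I' J' : Ideal A, I'.FG ∧ J'.FG ∧ I' ≤ I ∧ J' ≤ J ∧ F ≤ I' ⊔ J' := by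
  induction F, hF using Submodule.fg_induction with
  | singleton x =>
    obtain ⟨a, ha, b, hb, hab⟩ := Submodule.mem_sup.1 (h (Submodule.mem_span_singleton_self x))
    refine ⟨Ideal.span {a}, Ideal.span {b}, Submodule.fg_span_singleton a,
      Submodule.fg_span_singleton b, by simpa [Ideal.span_le], by simpa [Ideal.span_le], ?_⟩
    rw [Submodule.span_singleton_le_iff_mem, ← hab]
    exact Submodule.add_mem_sup (Ideal.mem_span_singleton_self a) (Ideal.mem_span_singleton_self b)
  | sup F₁ F₂ _ _ ih₁ ih₂ =>
    obtain ⟨I₁, J₁, hI₁, hJ₁, hI₁', hJ₁', h₁⟩ := ih₁ (le_sup_left.trans h)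
    obtain ⟨I₂, J₂, hI₂, hJ₂, hI₂', hJ₂', h₂⟩ := ih₂ (le_sup_right.trans h)
    exact ⟨I₁ ⊔ I₂, J₁ ⊔ J₂, Submodule.FG.sup hI₁ hI₂, Submodule.FG.sup hJ₁ hJ₂, sup_le hI₁' hI₂',
      sup_le hJ₁' hJ₂',
      sup_le (h₁.trans (sup_le_sup le_sup_left le_sup_left))
        (h₂.trans (sup_le_sup le_sup_right le_sup_right))⟩

theorem exists_fg_le_map {A B : Type*} [CommRing A] [CommRing B] {f : A →+* B} {I : Ideal A}
    {F : Ideal B} (hF : F.FG) (h : F ≤ I.map f) :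
    ∃ H : Ideal A, H.FG ∧ H ≤ I ∧ F ≤ H.map f := by
  induction F, hF using Submodule.fg_induction with
  | singleton x =>
    obtain ⟨t, ht, hxt⟩ :=
      Submodule.mem_span_finite_of_mem_span (h (Submodule.mem_span_singleton_self x))
    classical
    obtain ⟨s, hs, rfl⟩ := Finset.subset_set_image_iff.1 ht
    refine ⟨Ideal.span s, ⟨s, rfl⟩, Ideal.span_le.2 hs, ?_⟩
    rwa [Submodule.span_singleton_le_iff_mem, Ideal.map_span, ← Finset.coe_image]
  | sup F₁ F₂ _ _ ih₁ ih₂ =>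
    obtain ⟨H₁, hH₁, hH₁I, h₁⟩ := ih₁ (le_sup_left.trans h)
    obtain ⟨H₂, hH₂, hH₂I, h₂⟩ := ih₂ (le_sup_right.trans h)
    exact ⟨H₁ ⊔ H₂, Submodule.FG.sup hH₁ hH₂, sup_le hH₁I hH₂I,
      sup_le (h₁.trans (Ideal.map_mono le_sup_left)) (h₂.trans (Ideal.map_mono le_sup_right))⟩

/-! ### The `v`-closure of an ideal and `t`-ideals -/

section StarLemmas

variable {A : Type*} [CommRing A] (K : Type*) [Field K] [Algebra A K]

/-- The `v`-closure of an ideal `J` of `A`, as an ideal of `A`. -/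
noncomputable def vIdeal (J : Ideal A) : Ideal A :=
  (vClosure (coeSubmodule K J)).comap (Algebra.linearMap A K)

variable {K}

theorem mem_vIdeal {J : Ideal A} {r : A} :
    r ∈ vIdeal K J ↔ ∀ y : K, (∀ z ∈ J, y * algebraMap A K z ∈ (⊥ : Subalgebra A K)) →
      y * algebraMap A K r ∈ (⊥ : Subalgebra A K) := by
  simp [vIdeal, vClosure, Submodule.mem_div_iff_forall_mul_mem, Algebra.mem_bot, mul_comm]

theorem coeSubmodule_vIdeal (J : Ideal A) :
    coeSubmodule K (vIdeal K J) = vClosure (coeSubmodule K J) := by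
  refine le_antisymm (Submodule.map_comap_le _ _) fun x hx => ?_
  have h1 : x * 1 ∈ (1 : Submodule A K) := by
    refine Submodule.mem_div_iff_forall_mul_mem.1 hx 1 ?_
    refine Submodule.mem_div_iff_forall_mul_mem.2 fun y hy => ?_
    obtain ⟨a, -, rfl⟩ := (mem_coeSubmodule K J).1 hy
    simp
  obtain ⟨r, hr⟩ := Submodule.mem_one.1 h1
  rw [mul_one] at hr
  subst hr
  exact (mem_coeSubmodule K _).2 ⟨r, hx, rfl⟩

theorem le_vIdeal (J : Ideal A) : J ≤ vIdeal K J := fun r hr =>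
  mem_vIdeal.2 fun _ hy => hy r hr

theorem vIdeal_mono {I J : Ideal A} (h : I ≤ J) : vIdeal K I ≤ vIdeal K J := fun _ hr =>
  mem_vIdeal.2 fun y hy => mem_vIdeal.1 hr y fun z hz => hy z (h hz)

theorem vIdeal_le_of_le_vIdeal {I J : Ideal A} (h : I ≤ vIdeal K J) :
    vIdeal K I ≤ vIdeal K J := fun _ hr =>
  mem_vIdeal.2 fun y hy => mem_vIdeal.1 hr y fun _ hz => mem_vIdeal.1 (h hz) y hy

theorem vIdeal_eq_top_iff {J : Ideal A} :
    vIdeal K J = ⊤ ↔ ∀ y : K, (∀ z ∈ J, y * algebraMap A K z ∈ (⊥ : Subalgebra A K)) →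
      y ∈ (⊥ : Subalgebra A K) := by
  rw [Ideal.eq_top_iff_one, mem_vIdeal]
  simp

theorem vIdeal_eq_top_iff_div {J : Ideal A} :
    vIdeal K J = ⊤ ↔ (1 : Submodule A K) / coeSubmodule K J = 1 := by
  rw [vIdeal_eq_top_iff]
  have h : (1 : Submodule A K) ≤ 1 / coeSubmodule K J := by
    intro x hx
    refine Submodule.mem_div_iff_forall_mul_mem.2 fun y hy => ?_
    obtain ⟨a, -, rfl⟩ := (mem_coeSubmodule K J).1 hy
    obtain ⟨b, rfl⟩ := Submodule.mem_one.1 hx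
    exact Submodule.mem_one.2 ⟨b * a, map_mul _ _ _⟩
  rw [← h.ge_iff_eq']
  simp [SetLike.le_def, Submodule.mem_div_iff_forall_mul_mem, Algebra.mem_bot]

theorem mem_elemConductor {u : K} {r : A} :
    r ∈ elemConductor A u ↔ u * algebraMap A K r ∈ (⊥ : Subalgebra A K) := by
  simp [elemConductor, Algebra.mem_bot, Algebra.smul_def, mul_comm]

theorem vIdeal_le_elemConductor {J : Ideal A} {u : K} (h : J ≤ elemConductor A u) :
    vIdeal K J ≤ elemConductor A u := fun _ hr =>
  mem_elemConductor.2 (mem_vIdeal.1 hr u fun _ hz => mem_elemConductor.1 (h hz))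

theorem IsTIdeal.ne_bot {I : Ideal A} (h : IsTIdeal K I) : I ≠ ⊥ := h.1

theorem isVFinite_vIdeal {J : Ideal A} (hJ : J.FG) (hJ0 : J ≠ ⊥) : IsVFinite K (vIdeal K J) :=
  ⟨J, hJ, hJ0, coeSubmodule_vIdeal J⟩

theorem tMax_subset_tSpec : tMax A K ⊆ tSpec A K := fun _ hM => hM.1.2

theorem eq_of_tMax_le {M P : PrimeSpectrum A} (hM : M ∈ tMax A K) (hP : P ∈ tSpec A K)
    (h : M.asIdeal ≤ P.asIdeal) : P = M :=
  PrimeSpectrum.ext (le_antisymm (hM.2 ⟨P.isPrime.ne_top, hP⟩ h) h)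

theorem isAntichain_tMax : IsAntichain (· ≤ ·) (tMax A K) := fun _ hM _ hN hne hle =>
  hne (eq_of_tMax_le hM (tMax_subset_tSpec hN) hle).symm

variable [IsFractionRing A K]

theorem isTIdeal_iff {I : Ideal A} :
    IsTIdeal K I ↔ I ≠ ⊥ ∧ ∀ J : Ideal A, J.FG → J ≠ ⊥ → J ≤ I → vIdeal K J ≤ I := by
  have hinj : Function.Injective (algebraMap A K) := IsFractionRing.injective A K
  refine and_congr_right fun hI => ⟨fun h J hJ hJ0 hJI r hr => ?_, fun h => ?_⟩
  · have : algebraMap A K r ∈ (coeSubmodule K I : Set K) := by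
      rw [h]
      refine Set.mem_biUnion (x := coeSubmodule K J)
        ⟨(coeSubmodule_fg K hinj J).2 hJ, ?_, Submodule.map_mono hJI⟩ hr
      intro h0
      exact hJ0 (Submodule.map_injective_of_injective hinj (h0.trans (Submodule.map_bot _).symm))
    obtain ⟨a, ha, hra⟩ := (mem_coeSubmodule K I).1 this
    exact hinj hra ▸ ha
  · apply Set.Subset.antisymm
    · intro x hx
      obtain ⟨a, ha, rfl⟩ := (mem_coeSubmodule K I).1 hx
      obtain ⟨b, hb, hb0⟩ := Submodule.exists_mem_ne_zero_of_ne_bot hI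
      have hb' : algebraMap A K b ≠ 0 := by simpa using hb0
      refine Set.mem_biUnion (x := coeSubmodule K (Ideal.span {a} ⊔ Ideal.span {b}))
        ⟨(coeSubmodule_fg K hinj _).2
          ((Submodule.fg_span_singleton a).sup (Submodule.fg_span_singleton b)), ?_, ?_⟩ ?_
      · refine (Submodule.ne_bot_iff _).2 ⟨_, (mem_coeSubmodule K _).2 ⟨b, ?_, rfl⟩, hb'⟩
        exact Ideal.mem_sup_right (Ideal.mem_span_singleton_self b)
      · refine Submodule.map_mono (sup_le ?_ ?_) <;>
          simpa [Ideal.span_le]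
      · rw [← coeSubmodule_vIdeal]
        exact (mem_coeSubmodule K _).2
          ⟨a, le_vIdeal _ (Ideal.mem_sup_left (Ideal.mem_span_singleton_self a)), rfl⟩
    · intro x hx
      obtain ⟨J, ⟨hfg, hJ0, hJI⟩, hxJ⟩ := Set.mem_iUnion₂.1 hx
      obtain ⟨J', hJ'I, rfl⟩ : ∃ J' ≤ I, coeSubmodule K J' = J := by
        refine ⟨J.comap (Algebra.linearMap A K), fun a ha => ?_, ?_⟩
        · obtain ⟨b, hb, hab⟩ := (mem_coeSubmodule K I).1 (hJI ha)
          exact hinj hab ▸ hb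
        · exact Submodule.map_comap_eq_of_le (hJI.trans LinearMap.map_le_range)
      rw [coeSubmodule_fg K hinj] at hfg
      have hJ'0 : J' ≠ ⊥ := by
        rintro rfl
        exact hJ0 (Submodule.map_bot _)
      rw [← coeSubmodule_vIdeal] at hxJ
      exact Submodule.map_mono (h J' hfg hJ'0 hJ'I) hxJ

theorem IsTIdeal.vIdeal_le {I : Ideal A} (h : IsTIdeal K I) {J : Ideal A} (hJ : J.FG)
    (hJI : J ≤ I) : vIdeal K J ≤ I := by
  obtain ⟨b, hb, hb0⟩ := Submodule.exists_mem_ne_zero_of_ne_bot h.ne_bot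
  -- `J` may be zero, so it is enlarged by a nonzero element of `I`.
  refine (vIdeal_mono (le_sup_left : J ≤ J ⊔ Ideal.span {b})).trans
    ((isTIdeal_iff.1 h).2 _ (Submodule.FG.sup hJ (Submodule.fg_span_singleton b)) ?_
      (sup_le hJI ?_))
  · exact (Submodule.ne_bot_iff _).2
      ⟨b, Ideal.mem_sup_right (Ideal.mem_span_singleton_self b), hb0⟩
  · simpa [Ideal.span_le]

theorem isTIdeal_vIdeal {J : Ideal A} (hJ : J ≠ ⊥) : IsTIdeal K (vIdeal K J) :=
  isTIdeal_iff.2 ⟨fun h => hJ (le_bot_iff.1 (h ▸ le_vIdeal J)),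
    fun _ _ _ => vIdeal_le_of_le_vIdeal⟩

/-! ### Existence of maximal `t`-ideals -/

/-- Zorn's lemma is applied to the nonzero ideals whose finitely generated subideals all have a
proper `v`-closure; a maximal such ideal is automatically a `t`-ideal. -/
theorem exists_le_tMax {I : Ideal A} (hI : I ≠ ⊥)
    (h : ∀ J : Ideal A, J.FG → J ≤ I → vIdeal K J ≠ ⊤) : ∃ M ∈ tMax A K, I ≤ M.asIdeal := by
  let S : Set (Ideal A) := {I | ∀ J : Ideal A, J.FG → J ≤ I → vIdeal K J ≠ ⊤}
  obtain ⟨M, hIM, hM⟩ : ∃ M, I ≤ M ∧ Maximal (· ∈ S) M := by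
    refine zorn_le_nonempty₀ S (fun c hcS hc y hy => ⟨sSup c, ?_, fun z hz => le_sSup hz⟩) I h
    intro J hJ hJc
    obtain ⟨x, hx, hJx⟩ := (CompleteLattice.isCompactElement_iff_le_of_directed_sSup_le _ J).1
      ((Submodule.fg_iff_compact J).1 hJ) c ⟨y, hy⟩ hc.directedOn hJc
    exact hcS hx J hJ hJx
  have hM0 : M ≠ ⊥ := fun h0 => hI (le_bot_iff.1 (h0 ▸ hIM))
  have hMt : IsTIdeal K M := by
    refine isTIdeal_iff.2 ⟨hM0, fun J hJ _ hJM r hr => ?_⟩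
    have hmem : M ⊔ Ideal.span {r} ∈ S := by
      intro F hF hFle htop
      obtain ⟨F₁, F₂, hF₁, -, hF₁M, hF₂, hF'⟩ := exists_fg_le_sup hF hFle
      refine hM.prop (F₁ ⊔ J) (Submodule.FG.sup hF₁ hJ) (sup_le hF₁M hJM) (top_le_iff.1 ?_)
      rw [← htop]
      refine vIdeal_le_of_le_vIdeal (hF'.trans (sup_le (le_sup_left.trans (le_vIdeal _)) ?_))
      refine hF₂.trans ?_
      rw [Ideal.span_singleton_le_iff_mem]
      exact vIdeal_mono le_sup_right hr
    exact hM.le_of_ge hmem le_sup_left (Ideal.mem_sup_right (Ideal.mem_span_singleton_self r))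
  have hMmax : IsMaximalTIdeal K M := by
    refine ⟨⟨fun htop => ?_, hMt⟩, fun N hN hMN => hM.le_of_ge (fun J hJ hJN htop => ?_) hMN⟩
    · exact hM.prop ⊤ (Ideal.fg_top A) (htop ▸ le_rfl) (top_le_iff.1 (le_vIdeal _))
    · exact hN.1 (top_le_iff.1 (htop ▸ hN.2.vIdeal_le hJ hJN))
  exact ⟨⟨M, hMmax.isPrime⟩, hMmax, hIM⟩

theorem IsTIdeal.exists_le_tMax {I : Ideal A} (hI : IsTIdeal K I) (hI' : I ≠ ⊤) :
    ∃ M ∈ tMax A K, I ≤ M.asIdeal :=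
  TSharp.exists_le_tMax hI.ne_bot fun _ hJ hJI htop =>
    hI' (top_le_iff.1 (htop ▸ hI.vIdeal_le hJ hJI))

theorem exists_fg_vIdeal_eq_top {I : Ideal A} (hI : I ≠ ⊥)
    (h : ∀ M ∈ tMax A K, ¬ I ≤ M.asIdeal) : ∃ J : Ideal A, J.FG ∧ J ≤ I ∧ vIdeal K J = ⊤ := by
  by_contra! hcon
  obtain ⟨M, hM, hIM⟩ := TSharp.exists_le_tMax hI hcon
  exact h M hM hIM

theorem exists_tMax_of_tSpec {P : PrimeSpectrum A} (hP : P ∈ tSpec A K) :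
    ∃ M ∈ tMax A K, P.asIdeal ≤ M.asIdeal :=
  IsTIdeal.exists_le_tMax hP P.isPrime.ne_top

end StarLemmas

/-! ### Localizations and valuation primes -/

section LocalizationLemmas

theorem mem_of_elemConductor_inv {A K : Type*} [CommRing A] [Field K] [Algebra A K] {u : K}
    (hu : u ≠ 0) {r : A} (hr : r ∈ elemConductor A u⁻¹) :
    ∃ r' ∈ elemConductor A u, algebraMap A K r = u * algebraMap A K r' := by
  obtain ⟨r', hr'⟩ := Algebra.mem_bot.1 (mem_elemConductor.1 hr)
  refine ⟨r', mem_elemConductor.2 ?_, ?_⟩ <;> rw [hr', mul_inv_cancel_left₀ hu]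
  exact algebraMap_mem _ r

theorem algebraMap_ne_zero_of_notMem {A K : Type*} [CommRing A] [Field K] [Algebra A K]
    [IsFractionRing A K] {P : PrimeSpectrum A} {s : A} (hs : s ∉ P.asIdeal) :
    algebraMap A K s ≠ 0 := by
  have : s ≠ 0 := fun h => hs (h ▸ P.asIdeal.zero_mem)
  simpa using this

variable {A : Type*} [CommRing A] [IsDomain A] {K : Type*} [Field K] [Algebra A K]
  [IsFractionRing A K]

theorem elemConductor_ne_bot (u : K) : elemConductor A u ≠ ⊥ := by
  obtain ⟨a, b, hb, rfl⟩ := IsFractionRing.div_surjective A u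
  have hb0 : b ≠ 0 := nonZeroDivisors.ne_zero hb
  have hb' : algebraMap A K b ≠ 0 := by simpa using hb0
  refine (Submodule.ne_bot_iff _).2 ⟨b, mem_elemConductor.2 ?_, hb0⟩
  rw [div_mul_cancel₀ _ hb']
  exact algebraMap_mem _ a

theorem isTIdeal_elemConductor (u : K) : IsTIdeal K (elemConductor A u) :=
  isTIdeal_iff.2 ⟨elemConductor_ne_bot u, fun _ _ _ => vIdeal_le_elemConductor⟩

theorem mem_locAt {P : PrimeSpectrum A} {x : K} :
    x ∈ locAt K P ↔ ∃ a s : A, s ∉ P.asIdeal ∧ x * algebraMap A K s = algebraMap A K a := by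
  constructor
  · rintro ⟨a, s, hs, rfl⟩
    exact ⟨a, s, hs, inv_mul_cancel_right₀ (algebraMap_ne_zero_of_notMem hs) _⟩
  · rintro ⟨a, s, hs, h⟩
    exact ⟨a, s, hs, (eq_mul_inv_iff_mul_eq₀ (algebraMap_ne_zero_of_notMem hs)).2 h⟩

theorem mem_locAt_of_mul_mem {P : PrimeSpectrum A} {x : K} {s : A} (hs : s ∉ P.asIdeal)
    (h : x * algebraMap A K s ∈ (⊥ : Subalgebra A K)) : x ∈ locAt K P := by
  obtain ⟨a, ha⟩ := Algebra.mem_bot.1 h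
  exact mem_locAt.2 ⟨a, s, hs, ha.symm⟩

theorem mem_locAt_iff {P : PrimeSpectrum A} {x : K} :
    x ∈ locAt K P ↔ ¬ elemConductor A x ≤ P.asIdeal := by
  rw [SetLike.not_le_iff_exists]
  constructor
  · intro h
    obtain ⟨a, s, hs, h⟩ := mem_locAt.1 h
    exact ⟨s, mem_elemConductor.2 (h ▸ algebraMap_mem _ a), hs⟩
  · rintro ⟨s, hs, hsP⟩
    exact mem_locAt_of_mul_mem hsP (mem_elemConductor.1 hs)

theorem locAt_anti {P Q : PrimeSpectrum A} (h : P.asIdeal ≤ Q.asIdeal) :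
    locAt K Q ≤ locAt K P := fun _ hx =>
  mem_locAt_iff.2 fun hP => mem_locAt_iff.1 hx (hP.trans h)

theorem le_of_locAt_le {P Q : PrimeSpectrum A} (h : locAt K Q ≤ locAt K P) :
    P.asIdeal ≤ Q.asIdeal := by
  intro s hs
  by_contra hsQ
  have hs0 := algebraMap_ne_zero_of_notMem (K := K) hsQ
  have hmem : (algebraMap A K s)⁻¹ ∈ locAt K Q :=
    mem_locAt.2 ⟨1, s, hsQ, by rw [inv_mul_cancel₀ hs0, map_one]⟩
  obtain ⟨a, t, ht, hat⟩ := mem_locAt.1 (h hmem)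
  have : t = s * a := by
    apply IsFractionRing.injective A K
    rw [map_mul, ← hat, mul_inv_cancel_left₀ hs0]
  exact ht (this ▸ P.asIdeal.mul_mem_right a hs)

theorem mem_interLoc {Λ : Set (PrimeSpectrum A)} {x : K} :
    x ∈ interLoc K Λ ↔ ∀ P ∈ Λ, x ∈ locAt K P := by
  simp [interLoc, Algebra.mem_iInf]

theorem interLoc_anti {Λ Λ' : Set (PrimeSpectrum A)} (h : Λ ⊆ Λ') :
    interLoc K Λ' ≤ interLoc K Λ := fun _ hx =>
  mem_interLoc.2 fun P hP => mem_interLoc.1 hx P (h hP)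

theorem mem_bot_of_forall_tMax {x : K} (h : ∀ M ∈ tMax A K, x ∈ locAt K M) :
    x ∈ (⊥ : Subalgebra A K) := by
  by_contra hx
  obtain ⟨M, hM, hle⟩ := (isTIdeal_elemConductor x).exists_le_tMax fun htop => hx <| by
    simpa using (mem_elemConductor (A := A)).1 ((Ideal.eq_top_iff_one _).1 htop)
  exact mem_locAt_iff.1 (h M hM) hle

theorem coe_interLoc_eq_quotientRing (Λ : Set (PrimeSpectrum A)) :
    (interLoc K Λ : Set K) = quotientRing K (Phi K Λ) := by
  ext x
  rw [SetLike.mem_coe, mem_interLoc]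
  constructor
  · intro hx
    exact ⟨elemConductor A x, ⟨isTIdeal_elemConductor x, fun P hP => mem_locAt_iff.1 (hx P hP)⟩,
      fun a ha => Algebra.mem_bot.1 (mem_elemConductor.1 ha)⟩
  · rintro ⟨I, ⟨-, hI⟩, hIx⟩ P hP
    obtain ⟨s, hs, hsP⟩ := SetLike.not_le_iff_exists.1 (hI P hP)
    exact mem_locAt_of_mul_mem hsP (Algebra.mem_bot.2 (hIx s hs))

/-- It is enough to omit one maximal `t`-ideal at a time. -/
theorem isTSharp_iff :
    IsTSharp A K ↔ ∀ M ∈ tMax A K, ¬ interLoc K (tMax A K \ {M}) ≤ locAt K M := by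
  constructor
  · intro h M hM hle
    refine h (tMax A K \ {M}) (tMax A K) Set.sdiff_subset subset_rfl ?_ ?_
    · exact fun heq => (heq.symm ▸ hM : M ∈ tMax A K \ {M}).2 rfl
    · refine le_antisymm (fun x hx => mem_interLoc.2 fun N hN => ?_)
        (interLoc_anti Set.sdiff_subset)
      by_cases hNM : N = M
      · exact hNM ▸ hle hx
      · exact mem_interLoc.1 hx N ⟨hN, hNM⟩
  · intro h
    have aux : ∀ M₁ M₂ : Set (PrimeSpectrum A), M₁ ⊆ tMax A K → M₂ ⊆ tMax A K →
        interLoc K M₁ = interLoc K M₂ → M₁ ⊆ M₂ := by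
      intro M₁ M₂ h₁ h₂ heq M hM
      by_contra hM₂
      refine h M (h₁ hM) fun x hx => ?_
      have hx₂ : x ∈ interLoc K M₂ :=
        mem_interLoc.2 fun N hN =>
        mem_interLoc.1 hx N ⟨h₂ hN, fun hNM => hM₂ (hNM ▸ hN)⟩
      exact mem_interLoc.1 (heq ▸ hx₂) M hM
    exact fun M₁ M₂ h₁ h₂ hne heq => hne ((aux M₁ M₂ h₁ h₂ heq).antisymm (aux M₂ M₁ h₂ h₁ heq.symm))

variable (K) in
/-- `A_P` is a valuation ring of `K`. -/
def IsValuationAt (P : PrimeSpectrum A) : Prop :=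
  ∀ x : K, x ∈ locAt K P ∨ x⁻¹ ∈ locAt K P

theorem IsValuationAt.mono {P Q : PrimeSpectrum A} (hQ : IsValuationAt K Q)
    (h : P.asIdeal ≤ Q.asIdeal) : IsValuationAt K P := fun x =>
  (hQ x).imp (fun hx => locAt_anti h hx) fun hx => locAt_anti h hx

theorem IsValuationAt.of_valuationRing {P : PrimeSpectrum A} (h : ValuationRing (locAt K P)) :
    IsValuationAt K P := by
  have : IsFractionRing (locAt K P) K := Localization.subalgebra.isFractionRing_ofField _ _ _
  intro x
  rcases ValuationRing.isInteger_or_isInteger (locAt K P) x with ⟨y, hy⟩ | ⟨y, hy⟩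
  · exact Or.inl (hy ▸ y.2)
  · exact Or.inr (hy ▸ y.2)

/-- The primes below a valuation prime form a chain. -/
theorem IsValuationAt.le_total {M P Q : PrimeSpectrum A} (hM : IsValuationAt K M)
    (hP : P.asIdeal ≤ M.asIdeal) (hQ : Q.asIdeal ≤ M.asIdeal) : P ≤ Q ∨ Q ≤ P := by
  by_contra! hcon
  obtain ⟨a, haP, haQ⟩ := SetLike.not_le_iff_exists.1 (show ¬ P.asIdeal ≤ Q.asIdeal from hcon.1)
  obtain ⟨b, hbQ, hbP⟩ := SetLike.not_le_iff_exists.1 (show ¬ Q.asIdeal ≤ P.asIdeal from hcon.2)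
  have ha0 := algebraMap_ne_zero_of_notMem (K := K) haQ
  have hb0 := algebraMap_ne_zero_of_notMem (K := K) hbP
  rcases hM (algebraMap A K a / algebraMap A K b) with h | h
  · obtain ⟨c, s, hs, hcs⟩ := mem_locAt.1 h
    have : a * s = c * b := by
      apply IsFractionRing.injective A K
      rw [map_mul, map_mul, ← hcs]
      field_simp
    have hmem : a * s ∈ Q.asIdeal := this ▸ Q.asIdeal.mul_mem_left c hbQ
    exact (Q.isPrime.mem_or_mem hmem).elim haQ fun hsQ => hs (hQ hsQ)
  · obtain ⟨c, s, hs, hcs⟩ := mem_locAt.1 h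
    have : b * s = c * a := by
      apply IsFractionRing.injective A K
      rw [map_mul, map_mul, ← hcs]
      field_simp
    have hmem : b * s ∈ P.asIdeal := this ▸ P.asIdeal.mul_mem_left c haP
    exact (P.isPrime.mem_or_mem hmem).elim hbP fun hsP => hs (hP hsP)

theorem IsValuationAt.exists_generator {P : PrimeSpectrum A} (hP : IsValuationAt K P)
    {J : Ideal A} (hJ : J.FG) :
    ∃ j ∈ J, ∀ z ∈ J, ∃ x ∈ locAt K P, algebraMap A K z = x * algebraMap A K j := by
  induction J, hJ using Submodule.fg_induction with
  | singleton a =>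
    refine ⟨a, Submodule.mem_span_singleton_self a, fun z hz => ?_⟩
    obtain ⟨c, rfl⟩ := Submodule.mem_span_singleton.1 hz
    exact ⟨algebraMap A K c, algebraMap_mem _ c, by simp⟩
  | sup J₁ J₂ _ _ ih₁ ih₂ =>
    obtain ⟨j₁, hj₁, h₁⟩ := ih₁
    obtain ⟨j₂, hj₂, h₂⟩ := ih₂
    -- one of the two generators divides the other in the valuation ring
    have key : (∃ x ∈ locAt K P, algebraMap A K j₁ = x * algebraMap A K j₂) ∨
        ∃ x ∈ locAt K P, algebraMap A K j₂ = x * algebraMap A K j₁ := by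
      by_cases h1 : algebraMap A K j₁ = 0
      · exact Or.inl ⟨0, zero_mem _, by simp [h1]⟩
      by_cases h2 : algebraMap A K j₂ = 0
      · exact Or.inr ⟨0, zero_mem _, by simp [h2]⟩
      refine (hP (algebraMap A K j₁ / algebraMap A K j₂)).imp (fun h => ⟨_, h, ?_⟩)
        fun h => ⟨_, h, ?_⟩ <;> field_simp
    rcases key with ⟨x, hx, hxj⟩ | ⟨x, hx, hxj⟩
    · refine ⟨j₂, Ideal.mem_sup_right hj₂, fun z hz => ?_⟩
      obtain ⟨z₁, hz₁, z₂, hz₂, rfl⟩ := Submodule.mem_sup.1 hz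
      obtain ⟨x₁, hx₁, e₁⟩ := h₁ z₁ hz₁
      obtain ⟨x₂, hx₂, e₂⟩ := h₂ z₂ hz₂
      exact ⟨x₁ * x + x₂, add_mem (mul_mem hx₁ hx) hx₂, by rw [map_add, e₁, e₂, hxj]; ring⟩
    · refine ⟨j₁, Ideal.mem_sup_left hj₁, fun z hz => ?_⟩
      obtain ⟨z₁, hz₁, z₂, hz₂, rfl⟩ := Submodule.mem_sup.1 hz
      obtain ⟨x₁, hx₁, e₁⟩ := h₁ z₁ hz₁
      obtain ⟨x₂, hx₂, e₂⟩ := h₂ z₂ hz₂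
      exact ⟨x₁ + x₂ * x, add_mem hx₁ (mul_mem hx₂ hx), by rw [map_add, e₁, e₂, hxj]; ring⟩

theorem exists_common_denominator {P : PrimeSpectrum A} {J : Ideal A} (hJ : J.FG) {y : K}
    (h : ∀ z ∈ J, y * algebraMap A K z ∈ locAt K P) :
    ∃ s ∉ P.asIdeal, ∀ z ∈ J, algebraMap A K s * y * algebraMap A K z ∈ (⊥ : Subalgebra A K) := by
  induction J, hJ using Submodule.fg_induction with
  | singleton a =>
    obtain ⟨c, s, hs, hcs⟩ := mem_locAt.1 (h a (Submodule.mem_span_singleton_self a))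
    refine ⟨s, hs, fun z hz => ?_⟩
    obtain ⟨d, rfl⟩ := Submodule.mem_span_singleton.1 hz
    rw [smul_eq_mul, map_mul, show algebraMap A K s * y * (algebraMap A K d * algebraMap A K a) =
      algebraMap A K d * (y * algebraMap A K a * algebraMap A K s) by ring, hcs]
    exact mul_mem (algebraMap_mem _ d) (algebraMap_mem _ c)
  | sup J₁ J₂ _ _ ih₁ ih₂ =>
    obtain ⟨s₁, hs₁, h₁⟩ := ih₁ fun z hz => h z (Ideal.mem_sup_left hz)
    obtain ⟨s₂, hs₂, h₂⟩ := ih₂ fun z hz => h z (Ideal.mem_sup_right hz)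
    refine ⟨s₁ * s₂, fun hmem => (P.isPrime.mem_or_mem hmem).elim hs₁ hs₂, fun z hz => ?_⟩
    obtain ⟨z₁, hz₁, z₂, hz₂, rfl⟩ := Submodule.mem_sup.1 hz
    rw [map_mul, map_add, show algebraMap A K s₁ * algebraMap A K s₂ * y *
      (algebraMap A K z₁ + algebraMap A K z₂) =
        algebraMap A K s₂ * (algebraMap A K s₁ * y * algebraMap A K z₁) +
        algebraMap A K s₁ * (algebraMap A K s₂ * y * algebraMap A K z₂) by ring]
    exact add_mem (mul_mem (algebraMap_mem _ _) (h₁ z₁ hz₁))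
      (mul_mem (algebraMap_mem _ _) (h₂ z₂ hz₂))

/-- At a valuation prime `P`, a nonzero finitely generated ideal `J` is locally invertible:
`J J⁻¹ ⊄ P`, as witnessed by a single product `j y`. -/
theorem IsValuationAt.exists_mul_notMem {P : PrimeSpectrum A} (hP : IsValuationAt K P)
    {J : Ideal A} (hJ : J.FG) (hJ0 : J ≠ ⊥) :
    ∃ y : K, (∀ z ∈ J, y * algebraMap A K z ∈ (⊥ : Subalgebra A K)) ∧
      ∃ j ∈ J, ∃ s ∉ P.asIdeal, y * algebraMap A K j = algebraMap A K s := by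
  obtain ⟨j, hj, hgen⟩ := hP.exists_generator hJ
  have hj0 : algebraMap A K j ≠ 0 := by
    intro h0
    obtain ⟨b, hb, hb0⟩ := Submodule.exists_mem_ne_zero_of_ne_bot hJ0
    obtain ⟨x, -, hx⟩ := hgen b hb
    rw [h0, mul_zero] at hx
    exact hb0 (by simpa using hx)
  obtain ⟨s, hs, h⟩ := exists_common_denominator (P := P) hJ (y := (algebraMap A K j)⁻¹) <| by
    intro z hz
    obtain ⟨x, hx, hzx⟩ := hgen z hz
    rwa [hzx, mul_comm x, inv_mul_cancel_left₀ hj0]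
  exact ⟨_, h, j, hj, s, hs, inv_mul_cancel_right₀ hj0 _⟩

theorem IsValuationAt.mem_tSpec {P : PrimeSpectrum A} (hP : IsValuationAt K P)
    (hP0 : P.asIdeal ≠ ⊥) : P ∈ tSpec A K := by
  refine isTIdeal_iff.2 ⟨hP0, fun J hJ hJ0 hJP r hr => ?_⟩
  obtain ⟨y, hy, j, hj, s, hs, hyj⟩ := hP.exists_mul_notMem hJ hJ0
  obtain ⟨a, ha⟩ := Algebra.mem_bot.1 (mem_vIdeal.1 hr y hy)
  have : r * s = a * j := by
    apply IsFractionRing.injective A K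
    rw [map_mul, map_mul, ← hyj, ha]
    ring
  have hmem : r * s ∈ P.asIdeal := this ▸ P.asIdeal.mul_mem_left a (hJP hj)
  exact (P.isPrime.mem_or_mem hmem).resolve_right hs

/-! ### Conductors in Prüfer `v`-multiplication domains -/

/-- In a PVMD every conductor `(A : u)` is the `v`-closure of a finitely generated ideal `H`. With
`J = (1, u)` one has `J⁻¹ = (A : u)` and `J J⁻¹ = (A : u) + (A : u⁻¹)`, and this ideal lies in no
maximal `t`-ideal; so it contains a finitely generated ideal with `v`-closure `A`, and `H` collects
the finitely many elements of `J⁻¹` needed to generate it. -/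
theorem exists_fg_le_elemConductor (hA : ∀ M ∈ tMax A K, IsValuationAt K M) (u : K) :
    ∃ H : Ideal A, H.FG ∧ H ≤ elemConductor A u ∧ elemConductor A u ≤ vIdeal K H := by
  rcases eq_or_ne u 0 with rfl | hu
  · refine ⟨⊤, Ideal.fg_top A, fun r _ => mem_elemConductor.2 ?_, le_top.trans (le_vIdeal _)⟩
    rw [zero_mul]
    exact zero_mem _
  obtain ⟨F, hF, hFle, hFtop⟩ := exists_fg_vIdeal_eq_top (K := K)
    (I := elemConductor A u ⊔ elemConductor A u⁻¹)
    (fun h => elemConductor_ne_bot u (le_bot_iff.1 (h ▸ le_sup_left))) <| by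
      intro M hM hle
      exact (hA M hM u).elim (fun h => mem_locAt_iff.1 h (le_sup_left.trans hle))
        fun h => mem_locAt_iff.1 h (le_sup_right.trans hle)
  obtain ⟨H₁, H₂, hH₁, hH₂, hH₁u, hH₂u, hFH⟩ := exists_fg_le_sup hF hFle
  obtain ⟨H₃, hH₃, hH₃u, hH₂₃⟩ : ∃ H₃ : Ideal A, H₃.FG ∧ H₃ ≤ elemConductor A u ∧
      ∀ r ∈ H₂, ∃ r' ∈ H₃, algebraMap A K r = u * algebraMap A K r' := by
    clear hFH
    induction H₂, hH₂ using Submodule.fg_induction with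
    | singleton a =>
      obtain ⟨a', ha', haa'⟩ :=
        mem_of_elemConductor_inv hu (hH₂u (Submodule.mem_span_singleton_self a))
      refine ⟨Ideal.span {a'}, Submodule.fg_span_singleton a', by simpa [Ideal.span_le],
        fun r hr => ?_⟩
      obtain ⟨c, rfl⟩ := Submodule.mem_span_singleton.1 hr
      refine ⟨c * a', Ideal.mul_mem_left _ c (Ideal.mem_span_singleton_self a'), ?_⟩
      rw [smul_eq_mul, map_mul, map_mul, haa']
      ring
    | sup J₁ J₂ _ _ ih₁ ih₂ =>
      obtain ⟨I₁, hI₁, hI₁u, h₁⟩ := ih₁ (le_sup_left.trans hH₂u)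
      obtain ⟨I₂, hI₂, hI₂u, h₂⟩ := ih₂ (le_sup_right.trans hH₂u)
      refine ⟨I₁ ⊔ I₂, Submodule.FG.sup hI₁ hI₂, sup_le hI₁u hI₂u, fun r hr => ?_⟩
      obtain ⟨z₁, hz₁, z₂, hz₂, rfl⟩ := Submodule.mem_sup.1 hr
      obtain ⟨x₁, hx₁, e₁⟩ := h₁ z₁ hz₁
      obtain ⟨x₂, hx₂, e₂⟩ := h₂ z₂ hz₂
      exact ⟨x₁ + x₂, Submodule.add_mem_sup hx₁ hx₂, by rw [map_add, map_add, e₁, e₂]; ring⟩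
  refine ⟨H₁ ⊔ H₃, Submodule.FG.sup hH₁ hH₃, sup_le hH₁u hH₃u, fun r hr => ?_⟩
  refine mem_vIdeal.2 fun y hy => vIdeal_eq_top_iff.1 hFtop _ fun f hf => ?_
  obtain ⟨h₁, hh₁, h₂, hh₂, rfl⟩ := Submodule.mem_sup.1 (hFH hf)
  obtain ⟨h₃, hh₃, e₃⟩ := hH₂₃ h₂ hh₂
  rw [map_add, e₃, show y * algebraMap A K r * (algebraMap A K h₁ + u * algebraMap A K h₃) =
    algebraMap A K r * (y * algebraMap A K h₁) +
      u * algebraMap A K r * (y * algebraMap A K h₃) by ring]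
  exact add_mem (mul_mem (algebraMap_mem _ _) (hy h₁ (Ideal.mem_sup_left hh₁)))
    (mul_mem (mem_elemConductor.1 hr) (hy h₃ (Ideal.mem_sup_right hh₃)))

/-- In a PVMD that is a `t#`-domain, the maximal `t`-ideals are the only antichain of `t`-primes
that represents the domain as an intersection of localizations. If the maximal `t`-ideal `N` were
not in `Λ`, then at most one `Q ∈ Λ` would lie in `N`. A finitely generated ideal `J` contained in
`N`, but neither in `Q` nor in any other maximal `t`-ideal, would then satisfy
`J⁻¹ ⊆ ⋂_{Q ∈ Λ} A_Q = A`, which contradicts `J J⁻¹ ⊄ N`. -/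
theorem IsTSharp.eq_tMax_of_interLoc (hsharp : IsTSharp A K)
    (hA : ∀ M ∈ tMax A K, IsValuationAt K M) {Λ : Set (PrimeSpectrum A)}
    (hΛ : Λ ⊆ tSpec A K) (hanti : IsAntichain (· ≤ ·) Λ) (hbot : interLoc K Λ ≤ ⊥) :
    Λ = tMax A K := by
  have hsup : tMax A K ⊆ Λ := by
    intro N hN
    by_contra hNΛ
    obtain ⟨u, hu, huN⟩ := SetLike.not_le_iff_exists.1 (isTSharp_iff.1 hsharp N hN)
    obtain ⟨H, hH, hHu, huH⟩ := exists_fg_le_elemConductor hA u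
    have hHN : H ≤ N.asIdeal := hHu.trans (not_not.1 fun h => huN (mem_locAt_iff.2 h))
    have hHN' : ∀ N' ∈ tMax A K, N' ≠ N → ¬ H ≤ N'.asIdeal := fun N' hN' hne hle =>
      mem_locAt_iff.1 (mem_interLoc.1 hu N' ⟨hN', hne⟩)
        (huH.trans (hN'.1.2.vIdeal_le hH hle))
    obtain ⟨a, haN, ha0, haΛ⟩ : ∃ a ∈ N.asIdeal, a ≠ 0 ∧
        ∀ Q ∈ Λ, Q.asIdeal ≤ N.asIdeal → a ∉ Q.asIdeal := by
      by_cases hex : ∃ Q ∈ Λ, Q.asIdeal ≤ N.asIdeal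
      · obtain ⟨Q, hQ, hQN⟩ := hex
        obtain ⟨a, haN, haQ⟩ := SetLike.not_le_iff_exists.1 fun hle : N.asIdeal ≤ Q.asIdeal =>
          hNΛ (eq_of_tMax_le hN (hΛ hQ) hle ▸ hQ)
        refine ⟨a, haN, fun h0 => haQ (h0 ▸ Q.asIdeal.zero_mem), fun Q' hQ' hQ'N => ?_⟩
        have : Q' = Q := ((hA N hN).le_total hQ'N hQN).elim (hanti.eq hQ' hQ)
          fun h => (hanti.eq hQ hQ' h).symm
        exact this ▸ haQ
      · obtain ⟨a, haN, ha0⟩ := Submodule.exists_mem_ne_zero_of_ne_bot hN.1.2.ne_bot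
        exact ⟨a, haN, ha0, fun Q hQ hQN => (hex ⟨Q, hQ, hQN⟩).elim⟩
    have haJ : a ∈ H ⊔ Ideal.span {a} := Ideal.mem_sup_right (Ideal.mem_span_singleton_self a)
    have hJN : H ⊔ Ideal.span {a} ≤ N.asIdeal := sup_le hHN (by simpa [Ideal.span_le])
    obtain ⟨y, hy, j, hj, s, hs, hyj⟩ := (hA N hN).exists_mul_notMem
      (Submodule.FG.sup hH (Submodule.fg_span_singleton a))
      ((Submodule.ne_bot_iff _).2 ⟨a, haJ, ha0⟩)
    have hyA : y ∈ (⊥ : Subalgebra A K) := by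
      refine hbot (mem_interLoc.2 fun Q hQ => ?_)
      by_cases hQN : Q.asIdeal ≤ N.asIdeal
      · exact mem_locAt_of_mul_mem (haΛ Q hQ hQN) (hy a haJ)
      · obtain ⟨N', hN', hQN'⟩ := exists_tMax_of_tSpec (hΛ hQ)
        obtain ⟨h, hh, hhN'⟩ := SetLike.not_le_iff_exists.1
          (hHN' N' hN' fun heq => hQN (heq ▸ hQN'))
        exact mem_locAt_of_mul_mem (fun hhQ => hhN' (hQN' hhQ)) (hy h (Ideal.mem_sup_left hh))
    obtain ⟨b, rfl⟩ := Algebra.mem_bot.1 hyA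
    have : b * j = s := IsFractionRing.injective A K (by rw [map_mul, hyj])
    exact hs (this ▸ N.asIdeal.mul_mem_left b (hJN hj))
  refine Set.Subset.antisymm (fun Q hQ => ?_) hsup
  obtain ⟨N, hN, hQN⟩ := exists_tMax_of_tSpec (hΛ hQ)
  exact hanti.eq hQ (hsup hN) hQN ▸ hN

end LocalizationLemmas

/-! ### Overrings: `t`-linked, `t`-flat and `t`-subintersection -/

section Overrings

variable {R : Type*} [CommRing R] {K : Type*} [Field K] [Algebra R K] {T : Subalgebra R K}

theorem mem_contract {Q : PrimeSpectrum T} {r : R} :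
    r ∈ (contract T Q).asIdeal ↔ algebraMap R T r ∈ Q.asIdeal := Iff.rfl

theorem mem_bot_overring {x : K} : x ∈ (⊥ : Subalgebra T K) ↔ x ∈ T := by
  rw [Algebra.mem_bot]
  exact ⟨fun ⟨t, ht⟩ => ht ▸ t.2, fun hx => ⟨⟨x, hx⟩, rfl⟩⟩

variable [IsFractionRing R K]

theorem le_locAt {Q : PrimeSpectrum T} {x : K} (hx : x ∈ T) : x ∈ locAt K Q :=
  algebraMap_mem (locAt K Q) (⟨x, hx⟩ : T)

theorem mem_iff_forall_tMax {x : K} : x ∈ T ↔ ∀ N ∈ tMax T K, x ∈ locAt K N :=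
  ⟨fun hx _ _ => le_locAt hx, fun h => mem_bot_overring.1 (mem_bot_of_forall_tMax h)⟩

/-- A `t`-ideal of `R` contained in no contraction of a maximal `t`-ideal of `T` extends to an ideal
of `T` with `t`-closure `T`; finitely many of its elements already achieve this. -/
theorem isVFiniteSystem_Phi_image_contract (T : Subalgebra R K) :
    IsVFiniteSystem K (Phi K (contract T '' tMax T K)) := by
  intro I hI hIt
  obtain ⟨a, ha, ha0⟩ := Submodule.exists_mem_ne_zero_of_ne_bot hIt.ne_bot
  have hmap0 : I.map (algebraMap R T) ≠ ⊥ := by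
    refine (Submodule.ne_bot_iff _).2 ⟨_, Ideal.mem_map_of_mem _ ha, fun h0 => ha0 ?_⟩
    have h0' : algebraMap R K a = 0 := congrArg Subtype.val h0
    simpa using h0'
  obtain ⟨F, hF, hFI, hFtop⟩ := exists_fg_vIdeal_eq_top (K := K) hmap0 fun N hN hle =>
    hI.2 _ ⟨N, hN, rfl⟩ (Ideal.map_le_iff_le_comap.1 hle)
  obtain ⟨H, hH, hHI, hFH⟩ := exists_fg_le_map hF hFI
  have hJ0 : H ⊔ Ideal.span {a} ≠ ⊥ := (Submodule.ne_bot_iff _).2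
    ⟨a, Ideal.mem_sup_right (Ideal.mem_span_singleton_self a), ha0⟩
  have hJ := Submodule.FG.sup hH (Submodule.fg_span_singleton a)
  refine ⟨vIdeal K (H ⊔ Ideal.span {a}), ⟨isTIdeal_vIdeal hJ0, ?_⟩,
    hIt.vIdeal_le hJ (sup_le hHI (by simpa [Ideal.span_le])), isVFinite_vIdeal hJ hJ0⟩
  rintro _ ⟨N, hN, rfl⟩ hle
  have hFN : F ≤ N.asIdeal := hFH.trans <| Ideal.map_le_iff_le_comap.2 <|
    le_sup_left.trans ((le_vIdeal (K := K) _).trans hle)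
  exact N.isPrime.ne_top (top_le_iff.1 (hFtop ▸ hN.1.2.vIdeal_le hF hFN))

variable [IsDomain R]

theorem locAt_contract_subset (Q : PrimeSpectrum T) :
    (locAt K (contract T Q) : Set K) ⊆ locAt K Q := by
  intro x hx
  obtain ⟨a, s, hs, h⟩ := mem_locAt.1 hx
  exact mem_locAt.2 ⟨algebraMap R T a, algebraMap R T s, hs, h⟩

theorem contract_ne_bot {Q : PrimeSpectrum T} (hQ : Q.asIdeal ≠ ⊥) :
    (contract T Q).asIdeal ≠ ⊥ := by
  obtain ⟨t, ht, ht0⟩ := Submodule.exists_mem_ne_zero_of_ne_bot hQ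
  obtain ⟨a, b, hb, hab⟩ := IsFractionRing.div_surjective R (t : K)
  have hb0 : algebraMap R K b ≠ 0 := by simpa using nonZeroDivisors.ne_zero hb
  have ht0' : (t : K) ≠ 0 := by simpa using ht0
  rw [div_eq_iff hb0] at hab
  refine (Submodule.ne_bot_iff _).2 ⟨a, ?_, ?_⟩
  · rw [mem_contract, show algebraMap R T a = t * algebraMap R T b from Subtype.ext hab]
    exact Q.asIdeal.mul_mem_right _ ht
  · rintro rfl
    rw [map_zero] at hab
    exact mul_ne_zero ht0' hb0 hab.symm

/-- A valuation ring is maximal with respect to domination, so an overring is `t`-flat at a prime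
whose contraction is a valuation prime. -/
theorem locAt_eq_of_isValuationAt {Q : PrimeSpectrum T} (hQ : IsValuationAt K (contract T Q)) :
    (locAt K Q : Set K) = locAt K (contract T Q) := by
  refine Set.Subset.antisymm (fun x hx => ?_) (locAt_contract_subset Q)
  refine (hQ x).elim id fun hinv => ?_
  rcases eq_or_ne x 0 with rfl | hx0
  · exact zero_mem (locAt K (contract T Q))
  obtain ⟨a, s, hs, has⟩ := mem_locAt.1 hinv
  obtain ⟨t, w, hw, htw⟩ := mem_locAt.1 hx
  have ha : a ∉ (contract T Q).asIdeal := by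
    intro ha
    have : algebraMap R T s * w = t * algebraMap R T a := by
      apply Subtype.ext
      change algebraMap R K s * algebraMap T K w = algebraMap T K t * algebraMap R K a
      rw [← has, ← htw]
      field_simp
    have hmem : algebraMap R T s * w ∈ Q.asIdeal := this ▸ Q.asIdeal.mul_mem_left t ha
    exact (Q.isPrime.mem_or_mem hmem).elim hs hw
  exact mem_locAt.2 ⟨s, a, ha, by rw [← has, mul_inv_cancel_left₀ hx0]⟩

theorem IsTFlat.contract_mem_tSpec (hT : IsTFlat T) {N : PrimeSpectrum T} (hN : N ∈ tMax T K) :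
    contract T N ∈ tSpec R K := by
  refine isTIdeal_iff.2 ⟨contract_ne_bot hN.1.2.ne_bot, fun J hJ _ hJN r hr => ?_⟩
  refine hN.1.2.vIdeal_le (hJ.map (algebraMap R T)) (Ideal.map_le_iff_le_comap.2 hJN)
    (mem_vIdeal.2 fun y hy => ?_)
  refine mem_bot_overring.2 (mem_iff_forall_tMax.2 fun N' hN' => ?_)
  change _ ∈ (locAt K N' : Set K)
  rw [hT N' hN']
  obtain ⟨s, hs, hsy⟩ := exists_common_denominator (P := contract T N') hJ (y := y) <| by
    intro z hz
    rw [← SetLike.mem_coe, ← hT N' hN']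
    exact le_locAt (mem_bot_overring.1 (hy _ (Ideal.mem_map_of_mem _ hz)))
  refine mem_locAt_of_mul_mem hs ?_
  have := mem_vIdeal.1 hr _ hsy
  rwa [mul_comm _ (algebraMap R K s), ← mul_assoc]

theorem IsTFlat.mem_iff (hT : IsTFlat T) {x : K} :
    x ∈ T ↔ ∀ N ∈ tMax T K, x ∈ locAt K (contract T N) := by
  rw [mem_iff_forall_tMax]
  refine forall₂_congr fun N hN => ?_
  rw [← SetLike.mem_coe, hT N hN, SetLike.mem_coe]

theorem IsTFlat.eq_interLoc (hT : IsTFlat T) : T = interLoc K (contract T '' tMax T K) := by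
  ext x
  rw [hT.mem_iff, mem_interLoc, Set.forall_mem_image]

theorem IsTFlat.image_contract_subset (hT : IsTFlat T) : contract T '' tMax T K ⊆ tSpec R K :=
  Set.image_subset_iff.2 fun _ => hT.contract_mem_tSpec

theorem IsTFlat.isTSubintersection (hT : IsTFlat T) : IsTSubintersection T :=
  ⟨_, hT.image_contract_subset, hT.eq_interLoc⟩

theorem IsTFlat.le_of_contract_le (hT : IsTFlat T) {N N' : PrimeSpectrum T} (hN : N ∈ tMax T K)
    (hN' : N' ∈ tMax T K) (h : contract T N ≤ contract T N') : N ≤ N' := by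
  refine le_of_locAt_le (K := K) ?_
  rw [← SetLike.coe_subset_coe, hT N hN, hT N' hN']
  exact locAt_anti h

theorem IsTFlat.eq_of_contract_le (hT : IsTFlat T) {N N' : PrimeSpectrum T} (hN : N ∈ tMax T K)
    (hN' : N' ∈ tMax T K) (h : contract T N ≤ contract T N') : N = N' :=
  isAntichain_tMax.eq hN hN' (hT.le_of_contract_le hN hN' h)

theorem IsTFlat.isAntichain_image (hT : IsTFlat T) :
    IsAntichain (· ≤ ·) (contract T '' tMax T K) := by
  rintro _ ⟨N, hN, rfl⟩ _ ⟨N', hN', rfl⟩ hne hle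
  exact hne (congrArg _ (hT.eq_of_contract_le hN hN' hle))

theorem IsTSubintersection.isTLinked (hT : IsTSubintersection T) : IsTLinked T := by
  obtain ⟨Λ, hΛ, rfl⟩ := hT
  intro I hI hI1
  rw [← vIdeal_eq_top_iff_div] at hI1 ⊢
  refine vIdeal_eq_top_iff.2 fun y hy => mem_bot_overring.2 (mem_interLoc.2 fun P hP => ?_)
  obtain ⟨a, haI, haP⟩ := SetLike.not_le_iff_exists.1 fun hle : I ≤ P.asIdeal =>
    P.isPrime.ne_top (top_le_iff.1 (hI1 ▸ (hΛ hP).vIdeal_le hI hle))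
  have hmem := mem_interLoc.1 (mem_bot_overring.1 (hy _ (Ideal.mem_map_of_mem _ haI))) P hP
  obtain ⟨b, s, hs, hbs⟩ := mem_locAt.1 hmem
  refine mem_locAt.2 ⟨b, a * s, fun h => (P.isPrime.mem_or_mem h).elim haP hs, ?_⟩
  rw [map_mul, ← mul_assoc]
  exact hbs

theorem IsTLinked.exists_le_tMax (hT : IsTLinked T) {N : PrimeSpectrum T} (hN : N ∈ tMax T K) :
    ∃ M ∈ tMax R K, (contract T N).asIdeal ≤ M.asIdeal := by
  refine TSharp.exists_le_tMax (contract_ne_bot hN.1.2.ne_bot) fun J hJ hJN htop => ?_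
  have h1 := vIdeal_eq_top_iff_div.2 (hT J hJ (vIdeal_eq_top_iff_div.1 htop))
  exact N.isPrime.ne_top (top_le_iff.1 (h1 ▸ hN.1.2.vIdeal_le (hJ.map (algebraMap R T))
    (Ideal.map_le_iff_le_comap.2 hJN)))

theorem isValuationAt_of_tSpec (hR : ∀ M ∈ tMax R K, IsValuationAt K M) {P : PrimeSpectrum R}
    (hP : P ∈ tSpec R K) : IsValuationAt K P := by
  obtain ⟨M, hM, hPM⟩ := exists_tMax_of_tSpec hP
  exact (hR M hM).mono hPM

theorem IsTLinked.isTFlat (hR : ∀ M ∈ tMax R K, IsValuationAt K M) (hT : IsTLinked T) :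
    IsTFlat T := fun _ hN => by
  obtain ⟨M, hM, hNM⟩ := hT.exists_le_tMax hN
  exact locAt_eq_of_isValuationAt ((hR M hM).mono hNM)

theorem isValuationAt_of_locAt_eq {Q : PrimeSpectrum T} {P : PrimeSpectrum R}
    (hP : IsValuationAt K P) (h : (locAt K Q : Set K) = locAt K P) : IsValuationAt K Q := by
  intro x
  have := hP x
  rwa [← SetLike.mem_coe, ← SetLike.mem_coe, ← h] at this

/-- A `t`-flat overring of a PVMD is a PVMD. -/
theorem IsTFlat.isValuationAt (hR : ∀ M ∈ tMax R K, IsValuationAt K M) (hT : IsTFlat T) :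
    ∀ N ∈ tMax T K, IsValuationAt K N := fun N hN =>
  isValuationAt_of_locAt_eq (isValuationAt_of_tSpec hR (hT.contract_mem_tSpec hN)) (hT N hN)

/-- If `T ⊆ R_P`, then `P R_P ∩ T` is a prime of `T` with localization `R_P`. -/
theorem exists_lift {P : PrimeSpectrum R} (h : T ≤ locAt K P) :
    ∃ Q : PrimeSpectrum T, contract T Q = P ∧ (locAt K Q : Set K) = locAt K P := by
  have hloc : IsLocalization.AtPrime (locAt K P) P.asIdeal :=
    Localization.subalgebra.isLocalization_ofField _ _ _
  have : IsLocalRing (locAt K P) := IsLocalization.AtPrime.isLocalRing _ P.asIdeal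
  let Q : PrimeSpectrum T :=
    PrimeSpectrum.comap (Subalgebra.inclusion h).toRingHom (IsLocalRing.closedPoint (locAt K P))
  have hQP : contract T Q = P := PrimeSpectrum.ext
    (IsLocalization.AtPrime.under_maximalIdeal (locAt K P) P.asIdeal)
  refine ⟨Q, hQP, Set.Subset.antisymm (fun x hx => ?_) (hQP ▸ locAt_contract_subset Q)⟩
  obtain ⟨t, w, hw, htw⟩ := mem_locAt.1 hx
  -- an element of `T` outside `Q` is a unit of `R_P`
  have hunit : IsUnit (Subalgebra.inclusion h w) := by
    by_contra hcon
    exact hw ((IsLocalRing.mem_maximalIdeal _).2 hcon)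
  obtain ⟨v, hv⟩ := hunit.exists_right_inv
  have hv' : (w : K) * v = 1 := congrArg Subtype.val hv
  have hxt : x = (t : K) * v := by
    have htw' : x * (w : K) = t := htw
    rw [← htw', mul_assoc, hv', mul_one]
  rw [hxt]
  exact mul_mem (h t.2) v.2

theorem exists_lift_tSpec (hR : ∀ M ∈ tMax R K, IsValuationAt K M) {P : PrimeSpectrum R}
    (hP : P ∈ tSpec R K) (h : T ≤ locAt K P) :
    ∃ Q ∈ tSpec T K, contract T Q = P ∧ (locAt K Q : Set K) = locAt K P := by
  obtain ⟨Q, hQP, hloc⟩ := exists_lift h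
  refine ⟨Q, (isValuationAt_of_locAt_eq (isValuationAt_of_tSpec hR hP) hloc).mem_tSpec ?_,
    hQP, hloc⟩
  intro h0
  obtain ⟨p, hp, hp0⟩ := Submodule.exists_mem_ne_zero_of_ne_bot hP.ne_bot
  rw [← hQP, mem_contract, h0, Ideal.mem_bot] at hp
  have hp' : algebraMap R K p = 0 := congrArg Subtype.val hp
  exact hp0 (by simpa using hp')

/-- If a `t#`-domain `T` over a PVMD is represented by an antichain `Λ` of `t`-primes of the PVMD,
then `Λ` consists of the contractions of the maximal `t`-ideals of `T`. -/
theorem eq_image_contract (hR : ∀ M ∈ tMax R K, IsValuationAt K M) (hT : IsTFlat T)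
    (hsharp : IsTSharp T K) {Λ : Set (PrimeSpectrum R)} (hΛ : Λ ⊆ tSpec R K)
    (hanti : IsAntichain (· ≤ ·) Λ) (hTΛ : T = interLoc K Λ) : Λ = contract T '' tMax T K := by
  have hlift : ∀ P ∈ Λ, ∃ Q ∈ tSpec T K, contract T Q = P ∧ (locAt K Q : Set K) = locAt K P :=
    fun P hP => exists_lift_tSpec hR (hΛ hP) fun x hx => by
      rw [hTΛ] at hx
      exact mem_interLoc.1 hx P hP
  let Λ' : Set (PrimeSpectrum T) :=
    {Q | Q ∈ tSpec T K ∧ contract T Q ∈ Λ ∧ (locAt K Q : Set K) = locAt K (contract T Q)}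
  have himage : contract T '' Λ' = Λ := by
    refine Set.Subset.antisymm (Set.image_subset_iff.2 fun Q hQ => hQ.2.1) fun P hP => ?_
    obtain ⟨Q, hQ, rfl, hloc⟩ := hlift P hP
    exact ⟨Q, ⟨hQ, hP, hloc⟩, rfl⟩
  rw [← hsharp.eq_tMax_of_interLoc (hT.isValuationAt hR) (Λ := Λ') (fun Q hQ => hQ.1), himage]
  · intro Q hQ Q' hQ' hne hle
    have heq : contract T Q = contract T Q' :=
      hanti.eq hQ.2.1 hQ'.2.1 (Ideal.comap_mono hle)
    refine hne (le_antisymm hle (le_of_locAt_le (K := K) ?_))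
    rw [← SetLike.coe_subset_coe, hQ.2.2, hQ'.2.2, heq]
  · intro x hx
    rw [mem_bot_overring, hTΛ, mem_interLoc]
    intro P hP
    obtain ⟨Q, hQ, rfl, hloc⟩ := hlift P hP
    rw [← SetLike.mem_coe, ← hloc]
    exact mem_interLoc.1 hx Q ⟨hQ, hP, hloc⟩

/-- For a `t`-prime `P` of a PVMD, `(P : P) = R_P ∩ ⋂ R_M` with `M` ranging over the maximal
`t`-ideals that do not contain `P`. -/
theorem endoRing_eq_interLoc (hR : ∀ M ∈ tMax R K, IsValuationAt K M) {P : PrimeSpectrum R}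
    (hP : P ∈ tSpec R K) :
    endoRing K P.asIdeal = interLoc K (insert P {M ∈ tMax R K | ¬ P.asIdeal ≤ M.asIdeal}) := by
  have hval := isValuationAt_of_tSpec hR hP
  ext x
  rw [mem_interLoc, Set.forall_mem_insert]
  constructor
  · intro hx
    have hx' : ∀ p ∈ P.asIdeal, ∃ q ∈ P.asIdeal, algebraMap R K q = x * algebraMap R K p :=
      fun p hp => (mem_coeSubmodule K _).1 (hx _ ((mem_coeSubmodule K _).2 ⟨p, hp, rfl⟩))
    refine ⟨(hval x).elim id fun hinv => ?_, fun M hM => ?_⟩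
    · rcases eq_or_ne x 0 with rfl | hx0
      · exact zero_mem _
      obtain ⟨a, s, hs, has⟩ := mem_locAt.1 hinv
      refine mem_locAt.2 ⟨s, a, fun ha => hs ?_, by rw [← has, mul_inv_cancel_left₀ hx0]⟩
      obtain ⟨q, hq, hqa⟩ := hx' a ha
      rw [← has, mul_inv_cancel_left₀ hx0] at hqa
      exact IsFractionRing.injective R K hqa ▸ hq
    · obtain ⟨p, hp, hpM⟩ := SetLike.not_le_iff_exists.1 hM.2
      obtain ⟨q, -, hq⟩ := hx' p hp
      exact mem_locAt_of_mul_mem hpM (hq ▸ algebraMap_mem _ q)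
  · rintro ⟨hxP, hxM⟩ y hy
    obtain ⟨p, hp, rfl⟩ := (mem_coeSubmodule K _).1 hy
    obtain ⟨b, t, ht, hbt⟩ := mem_locAt.1 hxP
    have hmem : x * algebraMap R K p ∈ (⊥ : Subalgebra R K) := by
      refine mem_bot_of_forall_tMax fun M hM => ?_
      by_cases hPM : P.asIdeal ≤ M.asIdeal
      · -- here `x p ∈ P R_P = P R_M`, which holds as `R_M` is a valuation ring
        refine (hR M hM (x * algebraMap R K p)).elim id fun hinv => ?_
        rcases eq_or_ne (x * algebraMap R K p) 0 with h0 | h0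
        · rw [h0]
          exact zero_mem _
        obtain ⟨c, s, hs, hcs⟩ := mem_locAt.1 hinv
        have hst : s * t = c * (b * p) := by
          apply IsFractionRing.injective R K
          rw [map_mul, map_mul, map_mul, ← hcs, ← hbt,
            show (x * algebraMap R K p)⁻¹ * algebraMap R K s *
              (x * algebraMap R K t * algebraMap R K p) =
              (x * algebraMap R K p)⁻¹ * (x * algebraMap R K p) *
                (algebraMap R K s * algebraMap R K t) by ring, inv_mul_cancel₀ h0, one_mul]
        have hstP : s * t ∈ P.asIdeal :=
          hst ▸ P.asIdeal.mul_mem_left c (P.asIdeal.mul_mem_left b hp)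
        exact ((P.isPrime.mem_or_mem hstP).elim (fun hsP => hs (hPM hsP)) ht).elim
      · exact mul_mem (hxM M ⟨hM, hPM⟩) (algebraMap_mem _ p)
    obtain ⟨q, hq⟩ := Algebra.mem_bot.1 hmem
    refine (mem_coeSubmodule K _).2 ⟨q, ?_, hq⟩
    have hqt : q * t = b * p := by
      apply IsFractionRing.injective R K
      rw [map_mul, map_mul, hq, ← hbt]
      ring
    have hqtP : q * t ∈ P.asIdeal := hqt ▸ P.asIdeal.mul_mem_left b hp
    exact (P.isPrime.mem_or_mem hqtP).resolve_right ht

theorem isTSubintersection_endoRing (hR : ∀ M ∈ tMax R K, IsValuationAt K M)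
    {P : PrimeSpectrum R} (hP : P ∈ tSpec R K) : IsTSubintersection (endoRing K P.asIdeal) :=
  ⟨_, Set.insert_subset hP fun _ hM => tMax_subset_tSpec hM.1, endoRing_eq_interLoc hR hP⟩

/-! ### Sharpness of overrings -/

/-- A finitely generated `J ⊆ N ∩ R` lying in no maximal `t`-ideal of `R` that does not contain
`N ∩ R` separates `N` from all other maximal `t`-ideals of `T`, because the `t`-primes inside a
maximal `t`-ideal of a PVMD form a chain. -/
theorem IsTFlat.isTSharp (hR : ∀ M ∈ tMax R K, IsValuationAt K M)
    (hfg : ∀ P ∈ tSpec R K, ∃ J : Ideal R, J.FG ∧ J ≤ P.asIdeal ∧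
      ∀ M ∈ tMax R K, ¬ P.asIdeal ≤ M.asIdeal → ¬ J ≤ M.asIdeal) (hT : IsTFlat T) :
    IsTSharp T K := by
  refine isTSharp_iff.2 fun N hN hle => ?_
  have hP := hT.contract_mem_tSpec hN
  obtain ⟨J, hJ, hJP, hJM⟩ := hfg _ hP
  obtain ⟨p, hp, hp0⟩ := Submodule.exists_mem_ne_zero_of_ne_bot hP.ne_bot
  have hpJ : p ∈ J ⊔ Ideal.span {p} := Ideal.mem_sup_right (Ideal.mem_span_singleton_self p)
  have hJP' : J ⊔ Ideal.span {p} ≤ (contract T N).asIdeal :=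
    sup_le hJP (by simpa [Ideal.span_le] using hp)
  obtain ⟨y, hy, j, hj, s, hs, hyj⟩ := (isValuationAt_of_tSpec hR hP).exists_mul_notMem
    (Submodule.FG.sup hJ (Submodule.fg_span_singleton p))
    ((Submodule.ne_bot_iff _).2 ⟨p, hpJ, hp0⟩)
  have hyN : y ∈ locAt K N := by
    refine hle (mem_interLoc.2 fun N' ⟨hN', hne⟩ => ?_)
    have hP' := hT.contract_mem_tSpec hN'
    obtain ⟨M, hM, hP'M⟩ := exists_tMax_of_tSpec hP'
    have hJP'' : ¬ J ≤ (contract T N').asIdeal := by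
      intro hle'
      have hPM : (contract T N).asIdeal ≤ M.asIdeal :=
        not_not.1 fun hPM => hJM M hM hPM (hle'.trans hP'M)
      exact hne (((hR M hM).le_total hPM hP'M).elim
        (fun hc => (hT.eq_of_contract_le hN hN' hc).symm)
        fun hc => hT.eq_of_contract_le hN' hN hc)
    obtain ⟨z, hz, hzP'⟩ := SetLike.not_le_iff_exists.1 hJP''
    exact locAt_contract_subset N' (mem_locAt_of_mul_mem hzP' (hy z (Ideal.mem_sup_left hz)))
  rw [← SetLike.mem_coe, hT N hN] at hyN
  obtain ⟨a, t, ht, hat⟩ := mem_locAt.1 hyN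
  have hst : s * t = a * j := by
    apply IsFractionRing.injective R K
    rw [map_mul, map_mul, ← hyj, ← hat]
    ring
  have hmem : s * t ∈ (contract T N).asIdeal := hst ▸ Ideal.mul_mem_left _ a (hJP' hj)
  exact ((contract T N).isPrime.mem_or_mem hmem).elim hs ht

/-- If `⋂ R_M ⊆ R_P`, where `M` ranges over the maximal `t`-ideals not containing `P`, then
`(P : P) = ⋂ R_M`, and this representation does not involve the maximal `t`-ideals of `(P : P)`
that contain `P R_P ∩ (P : P)`. -/
theorem not_interLoc_le_of_isTSharp_endoRing (hR : ∀ M ∈ tMax R K, IsValuationAt K M)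
    {P : PrimeSpectrum R} (hP : P ∈ tSpec R K) (hsharp : IsTSharp (endoRing K P.asIdeal) K) :
    ¬ interLoc K {M ∈ tMax R K | ¬ P.asIdeal ≤ M.asIdeal} ≤ locAt K P := by
  intro hle
  have hflat := (isTSubintersection_endoRing hR hP).isTLinked.isTFlat hR
  have hT := endoRing_eq_interLoc hR hP
  have hloc : ∀ {Q}, Q ∈ insert P {M ∈ tMax R K | ¬ P.asIdeal ≤ M.asIdeal} →
      endoRing K P.asIdeal ≤ locAt K Q := fun {Q} hQ x hx => by
    rw [hT] at hx
    exact mem_interLoc.1 hx Q hQ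
  obtain ⟨Q, hQ, hQP, -⟩ := exists_lift_tSpec hR hP (hloc (Set.mem_insert _ _))
  obtain ⟨N, hN, hQN⟩ := exists_tMax_of_tSpec hQ
  have hPN : P.asIdeal ≤ (contract _ N).asIdeal :=
    (congrArg PrimeSpectrum.asIdeal hQP).ge.trans (Ideal.comap_mono hQN)
  refine isTSharp_iff.1 hsharp N hN fun u hu => le_locAt ?_
  have huM : u ∈ interLoc K {M ∈ tMax R K | ¬ P.asIdeal ≤ M.asIdeal} := by
    refine mem_interLoc.2 fun M hM => ?_
    obtain ⟨Q', hQ', hQ'M, hQ'loc⟩ := exists_lift_tSpec hR (tMax_subset_tSpec hM.1)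
      (hloc (Set.mem_insert_of_mem _ hM))
    obtain ⟨N', hN', hQN'⟩ := exists_tMax_of_tSpec hQ'
    have hne : N' ≠ N := by
      rintro rfl
      have hMN : M.asIdeal ≤ (contract _ N').asIdeal :=
        (congrArg PrimeSpectrum.asIdeal hQ'M).ge.trans (Ideal.comap_mono hQN')
      exact hM.2 (eq_of_tMax_le hM.1 (hflat.contract_mem_tSpec hN) hMN ▸ hPN)
    rw [← SetLike.mem_coe, ← hQ'loc]
    exact locAt_anti hQN' (mem_interLoc.1 hu N' ⟨hN', hne⟩)
  rw [hT, mem_interLoc, Set.forall_mem_insert]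
  exact ⟨hle huM, mem_interLoc.1 huM⟩

end Overrings

end TSharp

open TSharp in
theorem proposition2p7 {R : Type*} [CommRing R] [IsDomain R] {K : Type*} [Field K] [Algebra R K]
    [IsFractionRing R K] (hR : IsPVMD R K) :
    List.TFAE [
      -- (1)
      ∀ T : Subalgebra R K, IsTFlat T → IsTSharp T K,
      -- (2)
      ∀ T : Subalgebra R K, IsTSubintersection T → IsTSharp T K,
      -- (3)
      ∀ Λ : Set (PrimeSpectrum R), Λ ⊆ tSpec R K → IsAntichain (· ≤ ·) Λ →
        IsVFiniteSystem K (Phi K Λ),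
      -- (4)
      ∀ T : Subalgebra R K, IsTSubintersection T →
        ∃ Λ : Set (PrimeSpectrum R),
          (Λ ⊆ tSpec R K ∧ IsAntichain (· ≤ ·) Λ ∧ (T : Set K) = quotientRing K (Phi K Λ)) ∧
          (∀ Λ' : Set (PrimeSpectrum R), Λ' ⊆ tSpec R K → IsAntichain (· ≤ ·) Λ' →
            (T : Set K) = quotientRing K (Phi K Λ') → Λ' = Λ) ∧
          Λ = contract T '' tMax T K,
      -- (5)
      ∀ T : Subalgebra R K, IsTFlat T →
        ∀ Λ : Set (PrimeSpectrum T), Λ ⊆ tSpec T K → IsAntichain (· ≤ ·) Λ →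
          (T : Set K) = interLoc K Λ → Λ = tMax T K,
      -- (6)
      ∀ Λ : Set (PrimeSpectrum R), Λ ⊆ tMax R K → IsVFiniteSystem K (Phi K Λ),
      -- (7)
      ∀ P ∈ tSpec R K, ∃ J : Ideal R, J.FG ∧ J ≤ P.asIdeal ∧
        ∀ M ∈ tMax R K, ¬ P.asIdeal ≤ M.asIdeal → ¬ J ≤ M.asIdeal,
      -- (8)
      ∀ P ∈ tSpec R K, ∃ u : K, elemConductor R u ≤ P.asIdeal ∧
        ∀ M ∈ tMax R K, ¬ P.asIdeal ≤ M.asIdeal → ¬ elemConductor R u ≤ M.asIdeal,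
      -- (9)
      ∀ P ∈ tSpec R K, ¬ interLoc K {M ∈ tMax R K | ¬ P.asIdeal ≤ M.asIdeal} ≤ locAt K P,
      -- (10)
      ∀ T : Subalgebra R K, IsTLinked T → IsTSharp T K,
      -- (11)
      ∀ P ∈ tSpec R K, IsTSharp (endoRing K P.asIdeal) K] := by
  have hV : ∀ M ∈ tMax R K, IsValuationAt K M := fun M hM => .of_valuationRing (hR M hM)
  tfae_have 1 → 2 := fun h T hT => h T (hT.isTLinked.isTFlat hV)
  tfae_have 2 → 10 := fun h T hT => h T (hT.isTFlat hV).isTSubintersection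
  tfae_have 10 → 1 := fun h T hT => h T hT.isTSubintersection.isTLinked
  tfae_have 2 → 11 := fun h P hP => h _ (isTSubintersection_endoRing hV hP)
  tfae_have 11 → 9 := fun h P hP => not_interLoc_le_of_isTSharp_endoRing hV hP (h P hP)
  tfae_have 9 → 8 := fun h P hP => by
    obtain ⟨u, hu, huP⟩ := SetLike.not_le_iff_exists.1 (h P hP)
    exact ⟨u, not_not.1 fun hcon => huP (mem_locAt_iff.2 hcon),
      fun M hM hPM => mem_locAt_iff.1 (mem_interLoc.1 hu M ⟨hM, hPM⟩)⟩
  tfae_have 8 → 7 := fun h P hP => by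
    obtain ⟨u, huP, huM⟩ := h P hP
    obtain ⟨H, hH, hHu, huH⟩ := exists_fg_le_elemConductor hV u
    exact ⟨H, hH, hHu.trans huP, fun M hM hPM hHM =>
      huM M hM hPM (huH.trans (hM.1.2.vIdeal_le hH hHM))⟩
  tfae_have 7 → 1 := fun h T hT => hT.isTSharp hV h
  tfae_have 1 → 5 := fun h T hT Λ hΛ hanti hTΛ =>
    (h T hT).eq_tMax_of_interLoc (hT.isValuationAt hV) hΛ hanti fun x hx =>
      mem_bot_overring.2 (SetLike.mem_coe.1 (hTΛ ▸ SetLike.mem_coe.2 hx))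
  tfae_have 5 → 1 := fun h T hT => by
    refine isTSharp_iff.2 fun N hN hle => ?_
    have heq := h T hT (tMax T K \ {N}) (Set.sdiff_subset.trans tMax_subset_tSpec)
      (isAntichain_tMax.subset Set.sdiff_subset) ?_
    · exact (heq.symm ▸ hN : N ∈ tMax T K \ {N}).2 rfl
    · refine Set.Subset.antisymm (fun x hx => mem_interLoc.2 fun _ _ => le_locAt hx) fun x hx => ?_
      refine mem_iff_forall_tMax.2 fun N' hN' => ?_
      by_cases hne : N' = N
      · exact hne ▸ hle hx
      · exact mem_interLoc.1 hx N' ⟨hN', hne⟩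
  tfae_have 2 → 4 := fun h T hT => by
    have hflat := hT.isTLinked.isTFlat hV
    refine ⟨contract T '' tMax T K, ⟨hflat.image_contract_subset, hflat.isAntichain_image, ?_⟩,
      fun Λ hΛ hanti hTΛ => ?_, rfl⟩
    · rw [← coe_interLoc_eq_quotientRing, ← hflat.eq_interLoc]
    · rw [← coe_interLoc_eq_quotientRing] at hTΛ
      exact eq_image_contract hV hflat (h T hT) hΛ hanti (SetLike.coe_injective hTΛ)
  tfae_have 4 → 2 := fun h T hT => by
    have hflat := hT.isTLinked.isTFlat hV
    obtain ⟨Λ, -, huniq, rfl⟩ := h T hT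
    refine isTSharp_iff.2 fun N hN hle => ?_
    have hsub : contract T '' (tMax T K \ {N}) ⊆ contract T '' tMax T K :=
      Set.image_mono Set.sdiff_subset
    have heq := huniq (contract T '' (tMax T K \ {N})) (hsub.trans hflat.image_contract_subset)
      (hflat.isAntichain_image.subset hsub) ?_
    · obtain ⟨N', ⟨hN', hne⟩, hNN'⟩ :
          contract T N ∈ contract T '' (tMax T K \ {N}) := heq ▸ ⟨N, hN, rfl⟩
      exact hne (hflat.eq_of_contract_le hN' hN hNN'.le)
    · rw [← coe_interLoc_eq_quotientRing]
      ext x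
      rw [SetLike.mem_coe, SetLike.mem_coe, mem_interLoc, Set.forall_mem_image]
      refine ⟨fun hx N' hN' => hflat.mem_iff.1 hx N' hN'.1, fun hx => ?_⟩
      have hx' : ∀ N' ∈ tMax T K, N' ≠ N → x ∈ locAt K N' := fun N' hN' hne =>
        locAt_contract_subset N' (hx ⟨hN', hne⟩)
      refine mem_iff_forall_tMax.2 fun N' hN' => ?_
      by_cases hne : N' = N
      · exact hne ▸ hle (mem_interLoc.2 fun N'' hN'' => hx' N'' hN''.1 hN''.2)
      · exact hx' N' hN' hne
  tfae_have 2 → 3 := fun h Λ hΛ hanti I hI hIt => by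
    have hsub : IsTSubintersection (interLoc K Λ) := ⟨Λ, hΛ, rfl⟩
    have hflat := hsub.isTLinked.isTFlat hV
    have hΛ' := eq_image_contract hV hflat (h _ hsub) hΛ hanti rfl
    have hfin := isVFiniteSystem_Phi_image_contract (K := K) (interLoc K Λ)
    rw [← hΛ'] at hfin
    exact hfin I hI hIt
  tfae_have 3 → 6 := fun h Λ hΛ =>
    h Λ (hΛ.trans tMax_subset_tSpec) (isAntichain_tMax.subset hΛ)
  tfae_have 6 → 7 := fun h P hP => by
    obtain ⟨I, hI, hIP, J, hJ, hJ0, hIJ⟩ := h {M ∈ tMax R K | ¬ P.asIdeal ≤ M.asIdeal}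
      (fun M hM => hM.1) P.asIdeal ⟨hP, fun M hM => hM.2⟩ hP
    rw [← coeSubmodule_vIdeal] at hIJ
    have hIJ' : I = vIdeal K J :=
      Submodule.map_injective_of_injective (IsFractionRing.injective R K) hIJ
    subst hIJ'
    exact ⟨J, hJ, (le_vIdeal J).trans hIP, fun M hM hPM hJM =>
      hI.2 M ⟨hM, hPM⟩ (hM.1.2.vIdeal_le hJ hJM)⟩
  tfae_finish
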